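/- Let $0\le\gamma<w$. For $x\in\mathbb R$ and $N\in\mathbb N$ let $N_x$ be the integer nearest to $xw/\pi$ and put \[ \mathbb I_N(x)=\{n\in\mathbb Z:\ |xw/\pi-n|\le N\},\qquad \Gamma_N(x)=\Big\{z\in\mathbb C:\ \Big|z-N_x\frac{\pi}{w}\Big|<\Big(N+\frac12\Big)\frac{\pi}{w}\Big\}. \] For every $R\in\mathbb R$ there is $N_0\ge 1$, depending only on $w,\gamma,R$, such that the following holds. Let $f$ be an entire function of exponential type at most $\gamma$ (that is, for every $\varepsilon>0$ there is $C$ with $|f(z)|\le Ce^{(\gamma+\varepsilon)|z|}$ for all $z\in\mathbb C$) that is bounded on the real axis, and let \[ L_f=\sup_{t\in\mathbb R}|f(t)|,\qquad L_0(z)=\frac{4wL_f|\sin(wz)|}{\pi(w-\gamma)(1-e^{-\pi})}. \] Then for all integers $N\ge N_0$, all $x\in\mathbb R$ and all $z\in\Gamma_N(x)$ with $|z-x|\le R$, the two-sided series below (with $\frac{\sin u}{u}=1$ at $u=0$) converges, in the sense that its partial sums over $a\le n\le b$ have a limit as $a\to-\infty$ and $b\to+\infty$ independently, and \[ \Big|\sum_{n\in\mathbb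 Z\setminus\mathbb I_N(x)} f\Big(\frac{n\pi}{w}\Big)\,\frac{\sin(wz-n\pi)}{wz-n\pi}\Big|\ \le\ \frac{L_0(z)}{N}, \] with strict inequality whenever $f\not\equiv0$ and $\sin(wz)\ne0$. In particular, for fixed $f$, $x$ and $z\in\mathbb C$ the estimate holds for all sufficiently large $N$ (and then $z\in\Gamma_N(x)$ automatically). -/

import Mathlib

/-- `f` is of exponential type (at most) `γ`: for every `ε > 0` one has
`|f z| ≤ C_ε * exp ((γ + ε) |z|)` on the whole plane.  For an entire `f` and `0 ≤ γ` this says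
`limsup_{r → ∞} log (max_{|z| = r} |f z|) / r ≤ γ`; in particular every entire function whose
exponential type is exactly `γ` satisfies it. -/
def HasExponentialType (f : ℂ → ℂ) (γ : ℝ) : Prop :=
  ∀ ε : ℝ, 0 < ε → ∃ C : ℝ, ∀ z : ℂ, ‖f z‖ ≤ C * Real.exp ((γ + ε) * ‖z‖)

/-- `f` is bounded on the real axis. -/
def BoundedOnReals (f : ℂ → ℂ) : Prop :=
  BddAbove (Set.range fun x : ℝ => ‖f (x : ℂ)‖)

/-- The sup norm on the real axis, `L_f = sup_{x ∈ ℝ} |f x|`. -/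
noncomputable def realSupNorm (f : ℂ → ℂ) : ℝ :=
  ⨆ x : ℝ, ‖f (x : ℂ)‖

/-- The cardinal sine `sin u / u` of a complex variable, continuously extended by `1` at `0`. -/
noncomputable def complexSinc (u : ℂ) : ℂ :=
  if u = 0 then 1 else Complex.sin u / u

/-- The integer `N_x` nearest to `x w / π`. -/
noncomputable def nearestIndex (w x : ℝ) : ℤ :=
  round (x * w / Real.pi)

/-- The index set `I_N(x) = {n ∈ ℤ : |x w / π - n| ≤ N}`. -/
def sampleIndices (w x : ℝ) (N : ℕ) : Set ℤ :=
  {n : ℤ | |x * w / Real.pi - (n : ℝ)| ≤ (N : ℝ)}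

/-- The open disc `Γ_N(x)` with centre `N_x π / w` and radius `(N + 1/2) π / w`. -/
noncomputable def samplingDisc (w x : ℝ) (N : ℕ) : Set ℂ :=
  Metric.ball (((nearestIndex w x : ℝ) * (Real.pi / w) : ℝ) : ℂ)
    (((N : ℝ) + 1 / 2) * (Real.pi / w))

/-- The `n`-th term of the Whittaker-Kotel'nikov-Shannon sampling series of `f` at `z`. -/
noncomputable def wksTerm (f : ℂ → ℂ) (w : ℝ) (z : ℂ) (n : ℤ) : ℂ :=
  f (((n : ℝ) * Real.pi / w : ℝ) : ℂ) * complexSinc ((w : ℂ) * z - (n : ℂ) * (Real.pi : ℂ))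

/-- `L₀(z) = 4 w L_f |sin (w z)| / (π (w - γ) (1 - e^{-π}))`. -/
noncomputable def truncationConst (f : ℂ → ℂ) (w γ : ℝ) (z : ℂ) : ℝ :=
  4 * w * realSupNorm f * ‖Complex.sin ((w : ℂ) * z)‖ /
    (Real.pi * (w - γ) * (1 - Real.exp (-Real.pi)))

/-- The sampling series of `f` at `z` over the indices outside `I_N(x)` converges to `S`, as a
two-sided series: the sums over `n ∉ I_N(x)`, `a ≤ n ≤ b`, tend to `S` when `a → -∞` and `b → +∞`
independently of each other. (The series need not converge absolutely.) -/
def WKSTailHasSum (f : ℂ → ℂ) (w x : ℝ) (N : ℕ) (z S : ℂ) : Prop :=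
  HasSum (Set.indicator (sampleIndices w x N)ᶜ (wksTerm f w z)) S
    (SummationFilter.conditional ℤ)


/-!
Rescaling `z` by `w`, let `g` have type `σ < 1` and be bounded by `L` on the real axis, so that
`‖g ζ‖ ≤ L * exp (σ * |Im ζ|)` by Phragmén–Lindelöf. Cauchy's theorem for `G ζ / sin ζ`, with
`G ζ = g ζ / (Z - ζ)`, on the strip of width `π` around the node `n * π` expresses `G (n * π)` by
the integrals of `G / sin` along the two sides of the strip. Hence the `n`-th term of the cardinal
series is `r n - r (n + 1)`, where `r n` is such an integral along `Re ζ = (n - 1 / 2) * π`, and the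
tail telescopes to two of these. On that line `|sin ζ| = cosh (Im ζ) ≥ exp |Im ζ| / 2`, so `r n` is
at most a constant times `L / (1 - σ)` over the distance from `Z` to the line. For the two remaining
lines this distance is at least `(N - 1 / 2) * π - R * w`, which exceeds `(1 - exp (-π)) * N` for
large `N`.
-/

open Complex (I)
open Filter MeasureTheory Set Topology
open scoped Real

section ExponentialType

variable {E : Type*} [NormedAddCommGroup E] [NormedSpace ℂ E]

lemma norm_le_mul_exp_re_of_rightHalfPlane {F : ℂ → E} {C L τ : ℝ}
    (hF : DiffContOnCl ℂ F {z | 0 < z.re})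
    (hC : ∀ z : ℂ, 0 < z.re → ‖F z‖ ≤ C * Real.exp (τ * ‖z‖))
    (hL : ∀ y : ℝ, ‖F (y * I)‖ ≤ L) {z : ℂ} (hz : 0 ≤ z.re) :
    ‖F z‖ ≤ L * Real.exp (τ * z.re) := by
  have norm_smul_exp (ζ : ℂ) :
      ‖Complex.exp (-τ * ζ) • F ζ‖ = ‖F ζ‖ * Real.exp (-(τ * ζ.re)) := by
    rw [norm_smul, Complex.norm_exp, ← Complex.ofReal_neg, Complex.re_ofReal_mul, neg_mul, mul_comm]
  have h := PhragmenLindelof.right_half_plane_of_bounded_on_real (C := L)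
    (f := fun ζ => Complex.exp (-τ * ζ) • F ζ)
    (Differentiable.diffContOnCl (by fun_prop) |>.smul hF) ?growth ?real ?imaginary hz
  · rwa [norm_smul_exp, Real.exp_neg, ← div_eq_mul_inv, div_le_iff₀ (Real.exp_pos _)] at h
  case growth =>
    refine ⟨1, one_lt_two, τ + |τ|, Asymptotics.IsBigO.of_bound C ?_⟩
    filter_upwards [mem_inf_of_right (mem_principal_self _)] with ζ hζ
    have neg_mul_re_le : -(τ * ζ.re) ≤ |τ| * ‖ζ‖ := by
      calc -(τ * ζ.re) ≤ |τ * ζ.re| := neg_le_abs _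
        _ = |τ| * |ζ.re| := abs_mul _ _
        _ ≤ |τ| * ‖ζ‖ := by gcongr; exact Complex.abs_re_le_norm ζ
    rw [norm_smul_exp, Real.rpow_one, Real.norm_of_nonneg (Real.exp_pos _).le, add_mul,
      Real.exp_add, ← mul_assoc]
    gcongr
    · exact (norm_nonneg _).trans (hC ζ hζ)
    · exact hC ζ hζ
  case real =>
    refine isBoundedUnder_of_eventually_le (a := C) ?_
    filter_upwards [eventually_gt_atTop 0] with x hx
    have h := hC x (by simpa using hx)
    rw [Complex.norm_of_nonneg hx.le] at h
    rwa [norm_smul_exp, Complex.ofReal_re, Real.exp_neg, ← div_eq_mul_inv,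
      div_le_iff₀ (Real.exp_pos _)]
  case imaginary =>
    intro y
    rw [norm_smul_exp, Complex.re_ofReal_mul, Complex.I_re, mul_zero, mul_zero, neg_zero,
      Real.exp_zero, mul_one]
    exact hL y

lemma norm_le_mul_exp_abs_im {f : ℂ → E} {C L τ : ℝ} (hf : Differentiable ℂ f)
    (hC : ∀ z, ‖f z‖ ≤ C * Real.exp (τ * ‖z‖)) (hL : ∀ x : ℝ, ‖f x‖ ≤ L) (z : ℂ) :
    ‖f z‖ ≤ L * Real.exp (τ * |z.im|) := by
  have I_mul_mul_I (y : ℝ) : I * (y * I) = (-y : ℝ) := by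
    push_cast
    linear_combination (y : ℂ) * Complex.I_mul_I
  rcases le_total 0 z.im with him | him
  · have h := norm_le_mul_exp_re_of_rightHalfPlane (F := fun ζ => f (I * ζ)) (L := L) (τ := τ)
      (Differentiable.diffContOnCl (by fun_prop)) (fun ζ _ => by simpa using hC (I * ζ))
      (fun y => by simpa only [I_mul_mul_I] using hL (-y)) (z := -I * z) (by simpa)
    simpa [← mul_assoc, abs_of_nonneg him] using h
  · have h := norm_le_mul_exp_re_of_rightHalfPlane (F := fun ζ => f (-(I * ζ))) (L := L) (τ := τ)
      (Differentiable.diffContOnCl (by fun_prop)) (fun ζ _ => by simpa using hC (-(I * ζ)))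
      (fun y => by simpa [I_mul_mul_I] using hL y) (z := I * z) (by simpa)
    simpa [← mul_assoc, abs_of_nonpos him] using h

end ExponentialType

lemma HasExponentialType.norm_le {f : ℂ → ℂ} {γ L : ℝ} (hexp : HasExponentialType f γ)
    (hf : Differentiable ℂ f) (hL : ∀ x : ℝ, ‖f x‖ ≤ L) (z : ℂ) :
    ‖f z‖ ≤ L * Real.exp (γ * |z.im|) := by
  have hlim : Tendsto (fun ε : ℝ => L * Real.exp ((γ + ε) * |z.im|)) (𝓝[>] 0)
      (𝓝 (L * Real.exp (γ * |z.im|))) :=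
    (Continuous.tendsto' (by fun_prop) _ _ (by simp)).mono_left nhdsWithin_le_nhds
  refine ge_of_tendsto hlim ?_
  filter_upwards [self_mem_nhdsWithin] with ε hε
  obtain ⟨C, hC⟩ := hexp ε hε
  exact norm_le_mul_exp_abs_im hf hC hL z

lemma BoundedOnReals.norm_le {f : ℂ → ℂ} (hb : BoundedOnReals f) (x : ℝ) :
    ‖f x‖ ≤ realSupNorm f :=
  le_ciSup hb x

lemma BoundedOnReals.realSupNorm_pos {f : ℂ → ℂ} (hb : BoundedOnReals f)
    (hf : Differentiable ℂ f) (h0 : f ≠ 0) : 0 < realSupNorm f := by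
  contrapose! h0
  have eq_zero (x : ℝ) : f x = 0 := norm_le_zero_iff.1 ((hb.norm_le x).trans h0)
  have tendsto_ofReal : Tendsto (fun x : ℝ => (x : ℂ)) (𝓝[≠] 0) (𝓝[≠] 0) :=
    Complex.continuous_ofReal.continuousAt.continuousWithinAt.tendsto_nhdsWithin (t := {0}ᶜ)
      fun x hx => by simpa using hx
  exact AnalyticOnNhd.eq_of_frequently_eq (z₀ := 0) (fun z _ => hf.analyticAt z)
    (fun z _ => analyticAt_const) (tendsto_ofReal.frequently (Frequently.of_forall eq_zero))

section Sech

lemma integral_exp_neg_mul_abs {a : ℝ} (ha : 0 < a) :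
    ∫ x : ℝ, Real.exp (-a * |x|) = 2 / a := by
  rw [integral_comp_abs (f := fun x => Real.exp (-a * x)), integral_exp_mul_Ioi (neg_lt_zero.2 ha)]
  simp [div_eq_mul_inv]

lemma integrable_exp_neg_mul_abs {a : ℝ} (ha : 0 < a) :
    Integrable fun x : ℝ => Real.exp (-a * |x|) := by
  refine .of_integral_ne_zero ?_
  rw [integral_exp_neg_mul_abs ha]
  positivity

lemma exp_abs_div_two_le_cosh (x : ℝ) : Real.exp |x| / 2 ≤ Real.cosh x := by
  rw [← Real.cosh_abs, Real.cosh_eq]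
  linarith [Real.exp_pos (-|x|)]

lemma exp_div_four_le_sinh {x : ℝ} (hx : 1 ≤ x) : Real.exp x / 4 ≤ Real.sinh x := by
  rw [Real.sinh_eq]
  have : Real.exp (-x) ≤ 1 := Real.exp_le_one_iff.2 (by linarith)
  linarith [Real.add_one_le_exp x]

lemma abs_sinh_im_le_norm_sin (ζ : ℂ) : |Real.sinh ζ.im| ≤ ‖Complex.sin ζ‖ := by
  have sin_eq : Complex.sin ζ = (Real.sin ζ.re * Real.cosh ζ.im : ℝ)
      + (Real.cos ζ.re * Real.sinh ζ.im : ℝ) * I := by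
    rw [Complex.sin_eq]
    push_cast
    rfl
  refine abs_le_of_sq_le_sq ?_ (norm_nonneg _)
  rw [sin_eq, ← Complex.normSq_eq_norm_sq, Complex.normSq_add_mul_I]
  nlinarith [Real.cosh_sq ζ.im, Real.sin_sq_add_cos_sq ζ.re, sq_nonneg (Real.sin ζ.re)]

lemma norm_div_cosh_le {a : ℂ} {K σ η : ℝ} (ha : ‖a‖ ≤ K * Real.exp (σ * |η|)) :
    ‖a / Real.cosh η‖ ≤ 2 * K * Real.exp (-(1 - σ) * |η|) := by
  rw [norm_div, Complex.norm_of_nonneg (Real.cosh_pos η).le]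
  calc ‖a‖ / Real.cosh η ≤ K * Real.exp (σ * |η|) / (Real.exp |η| / 2) :=
        div_le_div₀ ((norm_nonneg a).trans ha) ha (by positivity) (exp_abs_div_two_le_cosh η)
    _ = 2 * K * (Real.exp (σ * |η|) / Real.exp |η|) := by field_simp
    _ = 2 * K * Real.exp (-(1 - σ) * |η|) := by rw [← Real.exp_sub]; ring_nf

lemma integrable_div_cosh {h : ℝ → ℂ} {K σ : ℝ} (hσ : σ < 1) (hc : Continuous h)
    (hh : ∀ η, ‖h η‖ ≤ K * Real.exp (σ * |η|)) :
    Integrable fun η : ℝ => h η / Real.cosh η := by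
  refine ((integrable_exp_neg_mul_abs (sub_pos.2 hσ)).const_mul (2 * K)).mono'
    (Continuous.aestronglyMeasurable ?_) (.of_forall fun η => norm_div_cosh_le (hh η))
  exact hc.div (Complex.continuous_ofReal.comp Real.continuous_cosh)
    fun η => by exact_mod_cast (Real.cosh_pos η).ne'

lemma integrable_inv_cosh : Integrable fun x : ℝ => (Real.cosh x)⁻¹ := by
  refine (integrable_div_cosh (h := fun _ => 1) (K := 1) zero_lt_one continuous_const
    (by simp)).norm.congr (.of_forall fun x => ?_)
  change ‖(1 : ℂ) / Real.cosh x‖ = (Real.cosh x)⁻¹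
  rw [norm_div, norm_one, Complex.norm_of_nonneg (Real.cosh_pos x).le, one_div]

lemma integral_inv_cosh : ∫ x : ℝ, (Real.cosh x)⁻¹ = π := by
  have hderiv (x : ℝ) : HasDerivAt (fun x => Real.arctan (Real.sinh x)) (Real.cosh x)⁻¹ x := by
    convert! (Real.hasDerivAt_sinh x).arctan using 1
    have := Real.cosh_pos x
    rw [add_comm 1, ← Real.cosh_sq]
    field_simp
  have htop : Tendsto (fun x => Real.arctan (Real.sinh x)) atTop (𝓝 (π / 2)) :=
    (tendsto_nhds_of_tendsto_nhdsWithin Real.tendsto_arctan_atTop).comp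
      Real.sinhOrderIso.tendsto_atTop
  have hbot : Tendsto (fun x => Real.arctan (Real.sinh x)) atBot (𝓝 (-(π / 2))) :=
    (tendsto_nhds_of_tendsto_nhdsWithin Real.tendsto_arctan_atBot).comp
      Real.sinhOrderIso.tendsto_atBot
  rw [integral_of_hasDerivAt_of_tendsto hderiv integrable_inv_cosh hbot htop]
  ring

/-- The integral of `G (c + iη) / cosh η` over `η ∈ ℝ`. On the lines `Re ζ = ±π / 2` the sine is
`±cosh η`, so there this is, up to a unimodular factor, the line integral of `G / sin`. -/
noncomputable def sechIntegral (G : ℂ → ℂ) (c : ℝ) : ℂ :=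
  ∫ η : ℝ, G (c + η * I) / Real.cosh η

lemma sechIntegral_const (a : ℂ) (c : ℝ) : sechIntegral (fun _ => a) c = a * π := by
  simp only [sechIntegral, div_eq_mul_inv, ← Complex.ofReal_inv]
  rw [integral_const_mul, integral_complex_ofReal, integral_inv_cosh]

lemma sechIntegral_comp_add_ofReal (G : ℂ → ℂ) (p c : ℝ) :
    sechIntegral (fun ζ => G (ζ + p)) c = sechIntegral G (p + c) := by
  have shift (η : ℝ) : (c : ℂ) + η * I + p = (p + c : ℝ) + η * I := by
    push_cast
    ring
  simp only [sechIntegral, shift]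

lemma norm_sechIntegral_le {G : ℂ → ℂ} {c K σ : ℝ} (hσ : σ < 1)
    (hG : ∀ η : ℝ, ‖G (c + η * I)‖ ≤ K * Real.exp (σ * |η|)) :
    ‖sechIntegral G c‖ ≤ 4 * K / (1 - σ) := by
  have hσ' : 0 < 1 - σ := sub_pos.2 hσ
  calc ‖sechIntegral G c‖ ≤ ∫ η : ℝ, 2 * K * Real.exp (-(1 - σ) * |η|) :=
        norm_integral_le_of_norm_le ((integrable_exp_neg_mul_abs hσ').const_mul _)
          (.of_forall fun η => norm_div_cosh_le (hG η))
    _ = 4 * K / (1 - σ) := by rw [integral_const_mul, integral_exp_neg_mul_abs hσ']; ring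

end Sech

section Strip

/-- The closed vertical strip of width `π` whose central line is `Re ζ = p`. -/
def closedStrip (p : ℝ) : Set ℂ :=
  {ζ | |ζ.re - p| ≤ π / 2}

lemma zero_mem_closedStrip_zero : (0 : ℂ) ∈ closedStrip 0 := by
  simpa [closedStrip] using Real.pi_div_two_pos.le

lemma closedStrip_zero_mem_nhds : closedStrip 0 ∈ 𝓝 (0 : ℂ) := by
  have hopen : IsOpen {ζ : ℂ | |ζ.re| < π / 2} := isOpen_lt (by fun_prop) (by fun_prop)
  refine mem_of_superset (hopen.mem_nhds (by simp [Real.pi_pos]))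
    fun ζ (hζ : |ζ.re| < π / 2) => ?_
  simpa [closedStrip] using hζ.le

lemma sin_ne_zero_of_mem_closedStrip {ζ : ℂ} (hζ : ζ ∈ closedStrip 0) (h0 : ζ ≠ 0) :
    Complex.sin ζ ≠ 0 := by
  intro hsin
  obtain ⟨k, rfl⟩ := Complex.sin_eq_zero_iff.1 hsin
  have hk : |(k : ℝ)| * π ≤ π / 2 := by
    simpa [closedStrip, abs_mul, abs_of_pos Real.pi_pos] using hζ
  have hk1 : |(k : ℝ)| < 1 := by nlinarith [Real.pi_pos]
  have hk0 : k = 0 := Int.abs_lt_one_iff.1 (by exact_mod_cast hk1)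
  exact h0 (by simp [hk0])

/-- The quotient `(G ζ - G 0) / sin ζ`, with its singularity at `0` removed: the two difference
quotients are continued by the derivatives there. -/
noncomputable def sinQuotient (G : ℂ → ℂ) (ζ : ℂ) : ℂ :=
  dslope G 0 ζ / dslope Complex.sin 0 ζ

lemma sinQuotient_of_ne (G : ℂ → ℂ) {ζ : ℂ} (hζ : ζ ≠ 0) :
    sinQuotient G ζ = (G ζ - G 0) / Complex.sin ζ := by
  rw [sinQuotient, dslope_of_ne _ hζ, dslope_of_ne _ hζ, slope_def_field, slope_def_field,
    Complex.sin_zero, sub_zero, sub_zero, div_div_div_cancel_right₀ hζ]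

lemma differentiableOn_sinQuotient {G : ℂ → ℂ} (hd : DifferentiableOn ℂ G (closedStrip 0)) :
    DifferentiableOn ℂ (sinQuotient G) (closedStrip 0) := by
  refine ((Complex.differentiableOn_dslope closedStrip_zero_mem_nhds).2 hd).div
    ((Complex.differentiableOn_dslope closedStrip_zero_mem_nhds).2
      Complex.differentiable_sin.differentiableOn) fun ζ hζ => ?_
  rcases eq_or_ne ζ 0 with rfl | h0
  · simp [dslope_same]
  · rw [dslope_of_ne _ h0, slope_def_field, Complex.sin_zero, sub_zero, sub_zero]
    exact div_ne_zero (sin_ne_zero_of_mem_closedStrip hζ h0) h0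

lemma norm_sinQuotient_le {G : ℂ → ℂ} {K σ : ℝ}
    (hG : ∀ ζ ∈ closedStrip 0, ‖G ζ‖ ≤ K * Real.exp (σ * |ζ.im|))
    {ζ : ℂ} (hζ : ζ ∈ closedStrip 0) (him : 1 ≤ |ζ.im|) :
    ‖sinQuotient G ζ‖ ≤ 4 * K * (Real.exp ((σ - 1) * |ζ.im|) + Real.exp (-|ζ.im|)) := by
  have hne : ζ ≠ 0 := by
    rintro rfl
    simp at him
    linarith
  have hnum : ‖G ζ - G 0‖ ≤ K * Real.exp (σ * |ζ.im|) + K :=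
    (norm_sub_le _ _).trans <| add_le_add (hG ζ hζ) (by simpa using hG 0 zero_mem_closedStrip_zero)
  have hden : Real.exp |ζ.im| / 4 ≤ ‖Complex.sin ζ‖ := by
    refine (exp_div_four_le_sinh him).trans ?_
    rw [← Real.abs_sinh]
    exact abs_sinh_im_le_norm_sin ζ
  rw [sinQuotient_of_ne G hne, norm_div]
  calc ‖G ζ - G 0‖ / ‖Complex.sin ζ‖
      ≤ (K * Real.exp (σ * |ζ.im|) + K) / (Real.exp |ζ.im| / 4) :=
        div_le_div₀ ((norm_nonneg _).trans hnum) hnum (by positivity) hden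
    _ = 4 * K * (Real.exp (σ * |ζ.im|) / Real.exp |ζ.im| + (Real.exp |ζ.im|)⁻¹) := by
        field_simp
    _ = 4 * K * (Real.exp ((σ - 1) * |ζ.im|) + Real.exp (-|ζ.im|)) := by
        rw [← Real.exp_sub, ← Real.exp_neg]; ring_nf

lemma tendsto_integral_sinQuotient_horizontal {G : ℂ → ℂ} {K σ : ℝ} (hσ : σ < 1)
    (hG : ∀ ζ ∈ closedStrip 0, ‖G ζ‖ ≤ K * Real.exp (σ * |ζ.im|)) :
    Tendsto (fun s : ℝ => ∫ x in -(π / 2)..π / 2, sinQuotient G (x + s * I)) (cocompact ℝ)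
      (𝓝 0) := by
  have habs : Tendsto (fun s : ℝ => |s|) (cocompact ℝ) atTop := tendsto_norm_cocompact_atTop
  have hexp {a : ℝ} (ha : a < 0) : Tendsto (fun s : ℝ => Real.exp (a * |s|)) (cocompact ℝ) (𝓝 0) :=
    Real.tendsto_exp_atBot.comp (habs.const_mul_atTop_of_neg ha)
  have hbound : Tendsto (fun s : ℝ => 4 * K * (Real.exp ((σ - 1) * |s|) + Real.exp (-|s|)) * π)
      (cocompact ℝ) (𝓝 0) := by
    simpa using (((hexp (sub_neg.2 hσ)).add (hexp neg_one_lt_zero)).const_mul (4 * K)).mul_const π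
  refine squeeze_zero_norm' ?_ hbound
  filter_upwards [habs.eventually_ge_atTop 1] with s hs
  have h := intervalIntegral.norm_integral_le_of_norm_le_const (a := -(π / 2)) (b := π / 2)
    (f := fun x : ℝ => sinQuotient G (x + s * I))
    (C := 4 * K * (Real.exp ((σ - 1) * |s|) + Real.exp (-|s|))) fun x hx => ?_
  · rwa [sub_neg_eq_add, add_halves, abs_of_pos Real.pi_pos] at h
  · rw [uIoc_of_le (by linarith [Real.pi_pos])] at hx
    simpa using norm_sinQuotient_le hG (ζ := x + s * I)
      (by simpa [closedStrip] using abs_le.2 ⟨hx.1.le, hx.2⟩) (by simpa using hs)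

lemma sinQuotient_add_mul_I (G : ℂ → ℂ) {c : ℝ} (hc : Real.cos c = 0) (η : ℝ) :
    sinQuotient G (c + η * I) = Real.sin c * ((G (c + η * I) - G 0) / Real.cosh η) := by
  have hne : (c : ℂ) + η * I ≠ 0 := by
    intro h
    have hc0 : c = 0 := by simpa using congrArg Complex.re h
    simp [hc0] at hc
  have hsin : (Real.sin c : ℂ) ^ 2 = 1 := by
    have := Real.sin_sq_add_cos_sq c
    rw [hc] at this
    exact_mod_cast (by linarith : Real.sin c ^ 2 = 1)
  have hs0 : (Real.sin c : ℂ) ≠ 0 := by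
    intro h
    simp [h] at hsin
  have hcosh : (Real.cosh η : ℂ) ≠ 0 := by exact_mod_cast (Real.cosh_pos η).ne'
  rw [sinQuotient_of_ne G hne, Complex.sin_add_mul_I, ← Complex.ofReal_cos, hc,
    ← Complex.ofReal_sin, ← Complex.ofReal_cosh, Complex.ofReal_zero, zero_mul, zero_mul, add_zero]
  field_simp
  linear_combination (G 0 - G (c + η * I)) * hsin

lemma tendsto_integral_sinQuotient_vertical {G : ℂ → ℂ} {K σ c : ℝ} (hσ : σ < 1)
    (hc : Real.cos c = 0) (hcont : Continuous fun η : ℝ => G (c + η * I))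
    (hG : ∀ η : ℝ, ‖G (c + η * I)‖ ≤ K * Real.exp (σ * |η|)) :
    Tendsto (fun H : ℝ => ∫ η in -H..H, sinQuotient G (c + η * I)) atTop
      (𝓝 (Real.sin c * (sechIntegral G c - G 0 * π))) := by
  have hint : Integrable fun η : ℝ => G (c + η * I) / Real.cosh η :=
    integrable_div_cosh hσ hcont hG
  have hint0 : Integrable fun η : ℝ => G 0 / Real.cosh η :=
    integrable_div_cosh (K := ‖G 0‖) zero_lt_one continuous_const (by simp)
  have hlim := (intervalIntegral_tendsto_integral (hint.sub hint0) tendsto_neg_atTop_atBot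
    tendsto_id).const_mul (Real.sin c : ℂ)
  have heq : ∫ η : ℝ, (G (c + η * I) / Real.cosh η - G 0 / Real.cosh η)
      = sechIntegral G c - G 0 * π := by
    rw [integral_sub hint hint0, ← sechIntegral_const (G 0) c]
    rfl
  simp only [Pi.sub_apply, heq] at hlim
  simpa only [sinQuotient_add_mul_I G hc, intervalIntegral.integral_const_mul, sub_div, id]
    using hlim

lemma integral_boundary_rect_sinQuotient {G : ℂ → ℂ}
    (hd : DifferentiableOn ℂ G (closedStrip 0)) (H : ℝ) :
    (∫ x in -(π / 2)..π / 2, sinQuotient G (x + (-H : ℝ) * I))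
      - (∫ x in -(π / 2)..π / 2, sinQuotient G (x + H * I))
      + I • (∫ η in -H..H, sinQuotient G ((π / 2 : ℝ) + η * I))
      - I • (∫ η in -H..H, sinQuotient G ((-(π / 2) : ℝ) + η * I)) = 0 := by
  refine Complex.integral_boundary_rect_eq_zero_of_differentiableOn (sinQuotient G)
    ⟨-(π / 2), -H⟩ ⟨π / 2, H⟩ ((differentiableOn_sinQuotient hd).mono fun ζ hζ => ?_)
  have hre := hζ.1
  rw [uIcc_of_le (by linarith [Real.pi_pos])] at hre
  simpa [closedStrip] using abs_le.2 hre

lemma sechIntegral_add_sechIntegral_zero {G : ℂ → ℂ} {K σ : ℝ} (hσ : σ < 1)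
    (hd : DifferentiableOn ℂ G (closedStrip 0))
    (hG : ∀ ζ ∈ closedStrip 0, ‖G ζ‖ ≤ K * Real.exp (σ * |ζ.im|)) :
    sechIntegral G (π / 2) + sechIntegral G (-(π / 2)) = 2 * π * G 0 := by
  have hmem {c : ℝ} (hc : |c| = π / 2) (η : ℝ) : (c : ℂ) + η * I ∈ closedStrip 0 := by
    simp [closedStrip, hc]
  have hvert {c : ℝ} (hc : |c| = π / 2) (hcos : Real.cos c = 0) :=
    tendsto_integral_sinQuotient_vertical hσ hcos
      (hd.continuousOn.comp_continuous (by fun_prop) (hmem hc))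
      (fun η => by simpa using hG _ (hmem hc η))
  have hhor := tendsto_integral_sinQuotient_horizontal hσ hG
  have hlim := (((hhor.comp (tendsto_neg_atTop_atBot.mono_right atBot_le_cocompact)).sub
    (hhor.mono_left atTop_le_cocompact)).add
      ((hvert (abs_of_pos Real.pi_div_two_pos) Real.cos_pi_div_two).const_smul I)).sub
      ((hvert (by rw [abs_neg, abs_of_pos Real.pi_div_two_pos]) (by simp)).const_smul I)
  have hzero := tendsto_nhds_unique hlim
    (tendsto_const_nhds.congr fun H => (integral_boundary_rect_sinQuotient hd H).symm)
  simp only [Real.sin_neg, Real.sin_pi_div_two, smul_eq_mul] at hzero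
  push_cast at hzero
  refine mul_left_cancel₀ Complex.I_ne_zero ?_
  linear_combination hzero

lemma sechIntegral_add_sechIntegral {G : ℂ → ℂ} {K σ p : ℝ} (hσ : σ < 1)
    (hd : DifferentiableOn ℂ G (closedStrip p))
    (hG : ∀ ζ ∈ closedStrip p, ‖G ζ‖ ≤ K * Real.exp (σ * |ζ.im|)) :
    sechIntegral G (p + π / 2) + sechIntegral G (p - π / 2) = 2 * π * G p := by
  have hmaps : MapsTo (fun ζ : ℂ => ζ + p) (closedStrip 0) (closedStrip p) := fun ζ hζ => by
    simpa [closedStrip] using hζ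
  have h := sechIntegral_add_sechIntegral_zero (G := fun ζ => G (ζ + p)) hσ
    (hd.comp (by fun_prop) hmaps) fun ζ hζ => by simpa using hG (ζ + p) (hmaps hζ)
  rwa [sechIntegral_comp_add_ofReal, sechIntegral_comp_add_ofReal, zero_add,
    ← sub_eq_add_neg] at h

end Strip

section Telescoping

variable {M : Type*} [AddCommGroup M]

lemma sum_Icc_sub_add_one (v : ℤ → M) {a b : ℤ} (hab : a ≤ b) :
    ∑ n ∈ Finset.Icc a b, (v n - v (n + 1)) = v a - v (b + 1) := by
  induction b, hab using Int.leInduction with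
  | base => simp
  | succ n hn ih =>
    rw [← Finset.insert_Icc_right_eq_Icc_add_one (by omega), Finset.sum_insert (by simp), ih]
    abel

variable [TopologicalSpace M]

lemma hasSum_conditional_sub_add_one [ContinuousSub M] {v : ℤ → M} {a b : M}
    (hbot : Tendsto v atBot (𝓝 a)) (htop : Tendsto v atTop (𝓝 b)) :
    HasSum (fun n => v n - v (n + 1)) (a - b) (SummationFilter.conditional ℤ) := by
  have hlim : Tendsto (fun p : ℤ × ℤ => v p.1 - v (p.2 + 1)) (atBot ×ˢ atTop) (𝓝 (a - b)) :=
    (hbot.comp tendsto_fst).sub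
      ((htop.comp (tendsto_atTop_add_const_right _ 1 tendsto_id)).comp tendsto_snd)
  rw [HasSum, SummationFilter.conditional_filter, tendsto_map'_iff]
  refine hlim.congr' ?_
  filter_upwards [(eventually_le_atBot (0 : ℤ)).prod_mk (eventually_ge_atTop (0 : ℤ))] with p hp
  exact (sum_Icc_sub_add_one v (hp.1.trans hp.2)).symm

variable [IsTopologicalAddGroup M]

lemma hasSum_conditional_indicator_Ioi {t u : ℤ → M} {m : ℤ} (hu : Tendsto u atTop (𝓝 0))
    (ht : ∀ n > m, t n = u n - u (n + 1)) :
    HasSum ((Ioi m).indicator t) (u (m + 1)) (SummationFilter.conditional ℤ) := by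
  have h := hasSum_conditional_sub_add_one (v := fun n => u (max n (m + 1))) (a := u (m + 1))
    (b := 0)
    (tendsto_const_nhds.congr' <| by
      filter_upwards [eventually_le_atBot (m + 1)] with n hn
      rw [max_eq_right hn])
    (hu.comp <| tendsto_atTop_mono (fun n => le_max_left n _) tendsto_id)
  rw [sub_zero] at h
  convert! h using 1
  ext n
  rcases le_or_gt n m with hn | hn
  · rw [indicator_of_notMem (by simpa using hn), max_eq_right (by omega), max_eq_right (by omega),
      sub_self]
  · rw [indicator_of_mem (mem_Ioi.2 hn), ht n hn, max_eq_left (by omega), max_eq_left (by omega)]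

lemma hasSum_conditional_indicator_Iio {t u : ℤ → M} {m : ℤ} (hu : Tendsto u atBot (𝓝 0))
    (ht : ∀ n < m, t n = u n - u (n + 1)) :
    HasSum ((Iio m).indicator t) (-u m) (SummationFilter.conditional ℤ) := by
  have h := hasSum_conditional_sub_add_one (v := fun n => u (min n m)) (a := 0) (b := u m)
    (hu.comp <| tendsto_atBot_mono (fun n => min_le_left n _) tendsto_id)
    (tendsto_const_nhds.congr' <| by
      filter_upwards [eventually_ge_atTop m] with n hn
      rw [min_eq_right hn])
  rw [zero_sub] at h
  convert! h using 1
  ext n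
  rcases le_or_gt m n with hn | hn
  · rw [indicator_of_notMem (by simpa using hn), min_eq_right hn, min_eq_right (by omega), sub_self]
  · rw [indicator_of_mem (mem_Iio.2 hn), ht n hn, min_eq_left hn.le, min_eq_left (by omega)]

lemma hasSum_conditional_indicator_compl_Icc {t u : ℤ → M} {lo hi : ℤ} (hle : lo ≤ hi + 1)
    (hu : Tendsto u cofinite (𝓝 0)) (hlo : ∀ n < lo, t n = u n - u (n + 1))
    (hhi : ∀ n > hi, t n = u n - u (n + 1)) :
    HasSum ((Icc lo hi)ᶜ.indicator t) (u (hi + 1) - u lo) (SummationFilter.conditional ℤ) := by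
  rw [Int.cofinite_eq, tendsto_sup] at hu
  have hdisj : Disjoint (Iio lo) (Ioi hi) :=
    disjoint_left.2 fun n (hn : n < lo) (hn' : hi < n) => by omega
  have hcompl : (Icc lo hi)ᶜ = Iio lo ∪ Ioi hi := by
    ext n
    simp only [mem_compl_iff, mem_Icc, not_and_or, not_le, mem_union, mem_Iio, mem_Ioi]
  rw [hcompl, indicator_union_of_disjoint hdisj, ← neg_add_eq_sub]
  exact (hasSum_conditional_indicator_Iio hu.1 hlo).add (hasSum_conditional_indicator_Ioi hu.2 hhi)

end Telescoping

section CardinalSeries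

/-- The remainder `r n` of the cardinal series of `g` at `Z`, in terms of which its `n`-th term is
`r n - r (n + 1)`. It is the contour integral of `g ζ * sin Z / (2πi (Z - ζ) sin ζ)` along
`Re ζ = (n - 1 / 2) π`, where `sin ζ = ±cosh (Im ζ)`, taken downwards. -/
noncomputable def cardinalRemainder (g : ℂ → ℂ) (Z : ℂ) (n : ℤ) : ℂ :=
  Complex.sin Z / (2 * π) * (-1) ^ n * sechIntegral (fun ζ => g ζ / (Z - ζ)) (n * π - π / 2)

lemma norm_div_sub_le {a Z ζ : ℂ} {d K : ℝ} (hd : 0 < d) (hζ : d ≤ |ζ.re - Z.re|)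
    (ha : ‖a‖ ≤ K) : ‖a / (Z - ζ)‖ ≤ K / d := by
  have hdist : d ≤ ‖Z - ζ‖ := by
    rw [abs_sub_comm, ← Complex.sub_re] at hζ
    exact hζ.trans (Complex.abs_re_le_norm _)
  rw [norm_div]
  exact div_le_div₀ ((norm_nonneg a).trans ha) ha hd hdist

variable {g : ℂ → ℂ} {Z : ℂ} {σ L : ℝ}

lemma norm_cardinalRemainder_le (hσ : σ < 1) (hgrow : ∀ ζ, ‖g ζ‖ ≤ L * Real.exp (σ * |ζ.im|))
    {n : ℤ} {d : ℝ} (hd : 0 < d) (hn : d ≤ |n * π - π / 2 - Z.re|) :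
    ‖cardinalRemainder g Z n‖ ≤ 2 * L * ‖Complex.sin Z‖ / (π * (1 - σ) * d) := by
  have hint : ‖sechIntegral (fun ζ => g ζ / (Z - ζ)) (n * π - π / 2)‖ ≤ 4 * (L / d) / (1 - σ) :=
    norm_sechIntegral_le hσ fun η => by
      simpa [div_mul_eq_mul_div] using
        norm_div_sub_le (ζ := (n * π - π / 2 : ℝ) + η * I) hd (by simpa using hn)
          (hgrow ((n * π - π / 2 : ℝ) + η * I))
  have hcoef : ‖Complex.sin Z / (2 * π) * (-1) ^ n‖ = ‖Complex.sin Z‖ / (2 * π) := by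
    simp [abs_of_pos Real.pi_pos]
  rw [cardinalRemainder, norm_mul, hcoef]
  calc ‖Complex.sin Z‖ / (2 * π) * ‖sechIntegral (fun ζ => g ζ / (Z - ζ)) (n * π - π / 2)‖
      ≤ ‖Complex.sin Z‖ / (2 * π) * (4 * (L / d) / (1 - σ)) := by gcongr
    _ = 2 * L * ‖Complex.sin Z‖ / (π * (1 - σ) * d) := by
      have : 1 - σ ≠ 0 := (sub_pos.2 hσ).ne'
      field_simp
      ring

lemma tendsto_cardinalRemainder_cofinite (hσ : σ < 1)
    (hgrow : ∀ ζ, ‖g ζ‖ ≤ L * Real.exp (σ * |ζ.im|)) :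
    Tendsto (cardinalRemainder g Z) cofinite (𝓝 0) := by
  have hdist : Tendsto (fun n : ℤ => |n * π - π / 2 - Z.re|) cofinite atTop := by
    have hlin := (tendsto_dist_right_cocompact_atTop ((π / 2 + Z.re) / π)).comp
      Int.tendsto_coe_cofinite |>.const_mul_atTop Real.pi_pos
    refine hlin.congr fun n => ?_
    have heq : n * π - π / 2 - Z.re = π * (n - (π / 2 + Z.re) / π) := by
      field_simp
      ring
    rw [heq, abs_mul, abs_of_pos Real.pi_pos]
    rfl
  have hbound : Tendsto (fun n : ℤ => 2 * L * ‖Complex.sin Z‖ /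
      (π * (1 - σ) * |n * π - π / 2 - Z.re|)) cofinite (𝓝 0) :=
    (hdist.const_mul_atTop (mul_pos Real.pi_pos (sub_pos.2 hσ))).const_div_atTop _
  refine squeeze_zero_norm' ?_ hbound
  filter_upwards [hdist.eventually_gt_atTop 0] with n hn
  exact norm_cardinalRemainder_le hσ hgrow hn le_rfl

lemma complexSinc_sub_int_mul_pi {n : ℤ} (hZ : Z ≠ n * π) :
    complexSinc (Z - n * π) = (-1) ^ n * Complex.sin Z / (Z - n * π) := by
  rw [complexSinc, if_neg (sub_ne_zero.2 hZ), Complex.sin_antiperiodic.sub_int_mul_eq,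
    Int.cast_negOnePow]

lemma mul_complexSinc_eq_cardinalRemainder_sub (hσ : σ < 1) (hg : Differentiable ℂ g)
    (hgrow : ∀ ζ, ‖g ζ‖ ≤ L * Real.exp (σ * |ζ.im|)) {n : ℤ} (hn : π / 2 < |n * π - Z.re|) :
    g (n * π) * complexSinc (Z - n * π)
      = cardinalRemainder g Z n - cardinalRemainder g Z (n + 1) := by
  obtain ⟨d, hd, hnd⟩ : ∃ d > 0, |n * π - Z.re| = π / 2 + d :=
    ⟨|n * π - Z.re| - π / 2, sub_pos.2 hn, by ring⟩
  have hdist {ζ : ℂ} (hζ : ζ ∈ closedStrip (n * π)) : d ≤ |ζ.re - Z.re| := by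
    have hζ' : |n * π - ζ.re| ≤ π / 2 := by rw [abs_sub_comm]; exact hζ
    linarith [abs_sub_le (n * π) ζ.re Z.re]
  have hne {ζ : ℂ} (hζ : ζ ∈ closedStrip (n * π)) : Z - ζ ≠ 0 := by
    intro h
    rw [sub_eq_zero.1 h] at hdist
    simpa using hd.trans_le (hdist hζ)
  have hcenter : Z - n * π ≠ 0 := by
    simpa using hne (ζ := (n * π : ℝ)) (by simpa [closedStrip] using Real.pi_div_two_pos.le)
  have hpoisson := sechIntegral_add_sechIntegral (G := fun ζ => g ζ / (Z - ζ)) (p := n * π)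
    (K := L / d) hσ
    (hg.differentiableOn.div (by fun_prop) fun ζ hζ => hne hζ) fun ζ hζ => by
      simpa [div_mul_eq_mul_div] using norm_div_sub_le hd (hdist hζ) (hgrow ζ)
  have hsucc : ((n + 1 : ℤ) : ℝ) * π - π / 2 = n * π + π / 2 := by
    push_cast
    ring
  have hpi : (π : ℂ) ≠ 0 := by exact_mod_cast Real.pi_ne_zero
  rw [complexSinc_sub_int_mul_pi (sub_ne_zero.1 hcenter), cardinalRemainder, cardinalRemainder,
    hsucc, zpow_add_one₀ (by norm_num)]
  calc g (n * π) * ((-1) ^ n * Complex.sin Z / (Z - n * π))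
      = Complex.sin Z / (2 * π) * (-1) ^ n *
          (2 * π * (g ((n * π : ℝ)) / (Z - (n * π : ℝ)))) := by
        push_cast
        field_simp
    _ = _ := by rw [← hpoisson]; ring

lemma exists_hasSum_cardinalSeries_tail (hσ : σ < 1) (hg : Differentiable ℂ g)
    (hgrow : ∀ ζ, ‖g ζ‖ ≤ L * Real.exp (σ * |ζ.im|)) {lo hi : ℤ} {D : ℝ} (hD : 0 < D)
    (hlo : (lo - 1 / 2) * π + D ≤ Z.re) (hhi : Z.re + D ≤ (hi + 1 / 2) * π) :
    ∃ S : ℂ, HasSum ((Icc lo hi)ᶜ.indicator fun n : ℤ => g (n * π) * complexSinc (Z - n * π)) S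
        (SummationFilter.conditional ℤ) ∧
      ‖S‖ ≤ 4 * L * ‖Complex.sin Z‖ / (π * (1 - σ) * D) := by
  have hpi := Real.pi_pos
  have hle : lo ≤ hi + 1 := by
    have h : ((lo : ℝ) - 1 / 2) < (hi + 1 / 2) := lt_of_mul_lt_mul_right (by linarith) hpi.le
    exact_mod_cast (by linarith : (lo : ℝ) ≤ hi + 1)
  refine ⟨cardinalRemainder g Z (hi + 1) - cardinalRemainder g Z lo,
    hasSum_conditional_indicator_compl_Icc hle (tendsto_cardinalRemainder_cofinite hσ hgrow)
      (fun n hn => mul_complexSinc_eq_cardinalRemainder_sub hσ hg hgrow ?_)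
      (fun n hn => mul_complexSinc_eq_cardinalRemainder_sub hσ hg hgrow ?_), ?_⟩
  · have hn' : (n : ℝ) + 1 ≤ lo := by exact_mod_cast hn
    exact lt_abs.2 (.inr (by nlinarith))
  · have hn' : (hi : ℝ) + 1 ≤ n := by exact_mod_cast hn
    exact lt_abs.2 (.inl (by nlinarith))
  · have hlo' : D ≤ |lo * π - π / 2 - Z.re| := le_abs.2 (.inr (by linarith))
    have hhi' : D ≤ |(hi + 1 : ℤ) * π - π / 2 - Z.re| :=
      le_abs.2 (.inl (by push_cast; linarith))
    calc ‖cardinalRemainder g Z (hi + 1) - cardinalRemainder g Z lo‖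
        ≤ ‖cardinalRemainder g Z (hi + 1)‖ + ‖cardinalRemainder g Z lo‖ := norm_sub_le _ _
      _ ≤ _ := add_le_add (norm_cardinalRemainder_le hσ hgrow hD hhi')
        (norm_cardinalRemainder_le hσ hgrow hD hlo')
      _ = 4 * L * ‖Complex.sin Z‖ / (π * (1 - σ) * D) := by ring

end CardinalSeries

section Truncation

lemma sampleIndices_eq_Icc (w x : ℝ) (N : ℕ) :
    sampleIndices w x N = Icc ⌈x * w / π - N⌉ ⌊x * w / π + N⌋ := by
  ext n
  simp only [sampleIndices, mem_ofPred_eq, mem_Icc, Int.ceil_le, Int.le_floor, abs_le]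
  constructor <;> rintro ⟨h1, h2⟩ <;> constructor <;> linarith

lemma exists_wksTailHasSum {f : ℂ → ℂ} {w γ : ℝ} (hw : 0 < w) (hγw : γ < w)
    (hf : Differentiable ℂ f) (hexp : HasExponentialType f γ) (hb : BoundedOnReals f)
    {N : ℕ} {x D : ℝ} {z : ℂ} (hD : 0 < D) (hz : ‖z - x‖ * w + D ≤ (N - 1 / 2) * π) :
    ∃ S : ℂ, WKSTailHasSum f w x N z S ∧
      ‖S‖ ≤ 4 * w * realSupNorm f * ‖Complex.sin (w * z)‖ / (π * (w - γ) * D) := by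
  have hgrow (ζ : ℂ) : ‖f (ζ / w)‖ ≤ realSupNorm f * Real.exp (γ / w * |ζ.im|) := by
    have h := hexp.norm_le hf hb.norm_le (ζ / w)
    rwa [Complex.div_ofReal_im, abs_div, abs_of_pos hw, mul_div_left_comm, mul_comm |ζ.im|] at h
  have hre : |(w * z : ℂ).re - x * w| ≤ ‖z - x‖ * w := by
    calc |(w * z : ℂ).re - x * w| = |(z - x).re| * w := by
          rw [← abs_of_pos hw, ← abs_mul, abs_of_pos hw]
          simp only [Complex.re_ofReal_mul, Complex.sub_re, Complex.ofReal_re]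
          ring_nf
      _ ≤ ‖z - x‖ * w := by gcongr; exact Complex.abs_re_le_norm _
  obtain ⟨hre_lower, hre_upper⟩ := abs_le.1 hre
  have hcancel : x * w / π * π = x * w := div_mul_cancel₀ _ Real.pi_ne_zero
  have hceil := mul_lt_mul_of_pos_right (Int.ceil_lt_add_one (x * w / π - N)) Real.pi_pos
  have hfloor := mul_lt_mul_of_pos_right (Int.lt_floor_add_one (x * w / π + N)) Real.pi_pos
  obtain ⟨S, hS, hSle⟩ := exists_hasSum_cardinalSeries_tail (g := fun ζ => f (ζ / w)) (Z := w * z)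
    (lo := ⌈x * w / π - N⌉) (hi := ⌊x * w / π + N⌋) ((div_lt_one hw).2 hγw) (by fun_prop) hgrow hD
    (by linarith) (by linarith)
  refine ⟨S, ?_, hSle.trans_eq ?_⟩
  · rw [WKSTailHasSum, sampleIndices_eq_Icc]
    convert! hS using 2
    ext n
    simp [wksTerm]
  · have : 1 - γ / w = (w - γ) / w := by field_simp
    rw [this]
    field_simp

lemma one_sub_exp_neg_pi_pos : 0 < 1 - Real.exp (-π) :=
  sub_pos.2 (Real.exp_lt_one_iff.2 (neg_lt_zero.2 Real.pi_pos))

lemma one_sub_exp_neg_pi_mul_lt {N r : ℝ} (hr : 0 ≤ r) (hN : r + 2 ≤ N) :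
    (1 - Real.exp (-π)) * N < (N - 1 / 2) * π - r := by
  have hle : (1 - Real.exp (-π)) * N ≤ N :=
    mul_le_of_le_one_left (by linarith) (by linarith [Real.exp_pos (-π)])
  have hlt : (N - 1 / 2) * 3 < (N - 1 / 2) * π :=
    mul_lt_mul_of_pos_left Real.pi_gt_three (by linarith)
  linarith

lemma truncationConst_div (f : ℂ → ℂ) (w γ N : ℝ) (z : ℂ) :
    truncationConst f w γ z / N = 4 * w * realSupNorm f * ‖Complex.sin (w * z)‖ /
      (π * (w - γ) * ((1 - Real.exp (-π)) * N)) := by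
  rw [truncationConst, div_div, mul_assoc _ _ N]

end Truncation

theorem theorem1 (w γ R : ℝ) (hγ : 0 ≤ γ) (hγw : γ < w) :
    ∃ N₀ : ℕ, 1 ≤ N₀ ∧
      ∀ f : ℂ → ℂ, Differentiable ℂ f → HasExponentialType f γ → BoundedOnReals f →
        ∀ (N : ℕ) (x : ℝ) (z : ℂ), N₀ ≤ N → z ∈ samplingDisc w x N → ‖z - (x : ℂ)‖ ≤ R →
          ∃ S : ℂ, WKSTailHasSum f w x N z S ∧
            ‖S‖ ≤ truncationConst f w γ z / (N : ℝ) ∧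
            (f ≠ 0 → Complex.sin ((w : ℂ) * z) ≠ 0 →
              ‖S‖ < truncationConst f w γ z / (N : ℝ)) := by
  have hw : 0 < w := hγ.trans_lt hγw
  refine ⟨⌈R * w⌉₊ + 2, by omega, fun f hf hexp hb N x z hN _ hzx => ?_⟩
  have hNR : R * w + 2 ≤ N := by
    have hN' : (⌈R * w⌉₊ : ℝ) + 2 ≤ N := by exact_mod_cast hN
    linarith [Nat.le_ceil (R * w)]
  have hRw : 0 ≤ R * w := mul_nonneg ((norm_nonneg _).trans hzx) hw.le
  have hlt := one_sub_exp_neg_pi_mul_lt hRw hNR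
  have hpos : 0 < (1 - Real.exp (-π)) * N := mul_pos one_sub_exp_neg_pi_pos (by linarith)
  obtain ⟨S, hS, hSle⟩ := exists_wksTailHasSum hw hγw hf hexp hb (hpos.trans hlt)
    (show ‖z - x‖ * w + ((N - 1 / 2) * π - R * w) ≤ (N - 1 / 2) * π by
      linarith [mul_le_mul_of_nonneg_right hzx hw.le])
  have : 0 < π * (w - γ) := mul_pos Real.pi_pos (sub_pos.2 hγw)
  have hL : 0 ≤ realSupNorm f := (norm_nonneg _).trans (hb.norm_le 0)
  rw [truncationConst_div]
  refine ⟨S, hS, hSle.trans (by gcongr), fun hf0 hsin => hSle.trans_lt ?_⟩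
  have hLpos := hb.realSupNorm_pos hf hf0
  have := norm_pos_iff.2 hsin
  gcongr
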